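/- **Theorem (second characterization of the peak shuffle algebra $\mathcal A_{\mathrm{pk}}$).** A linear permutation is a finite word $\pi=\pi_1\cdots\pi_n$ ($n=|\pi|\ge 0$) of distinct positive integers; $\mathrm{pk}\,\pi$ is the number of its peaks, i.e. of $i\in\{2,\dots,n-1\}$ with $\pi_{i-1}<\pi_i>\pi_{i+1}$. If $\pi,\sigma$ have no common letter, let $S(\pi,\sigma)$ be the set of linear permutations of length $|\pi|+|\sigma|$ that contain $\pi$ and $\sigma$ as subsequences. Let $[\pi]_{\mathrm{pk}}$ denote the class of $\pi$ under the relation $|\pi|=|\pi'|$, $\mathrm{pk}\,\pi=\mathrm{pk}\,\pi'$. Then $\mathrm{pk}$ is shuffle compatible: for disjoint $\pi,\sigma$ the multiset $\{\{\mathrm{pk}\,\tau:\tau\inS(\pi,\sigma)\}\}$ depends only on $|\pi|,|\sigma|,\mathrm{pk}\,\pi,\mathrm{pk}\,\sigma$. Hence the $\mathbb Q$-vector space with basis the classes $[\pi]_{\mathrm{pk}}$ is an algebra $\mathcal A_{\mathrm{pk}}$ under $[\pi]_{\mathrm{pk}}[\sigma]_{\mathrm{pk}}=\sum_{\tau\inS(\pi,\sigma)}[\tau]_{\mathrm{pk}}$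 ($\pi,\sigma$ disjoint). For $n\ge1$ and $0\le j\le\lfloor (n-1)/2\rfloor$ let $\theta_{n,j}:\mathbb N\to\mathbb Q[x]$, $\mathbb N=\{0,1,2,\dots\}$, be $$\theta_{n,j}(m)=2^{2j+1}\sum_{k=0}^{m-1-j}\left(\!\!\binom{n+1}{k}\!\!\right)\binom{n-2j-1}{m-1-j-k}\,x^n ,$$ where $\left(\!\binom{a}{k}\!\right)=\binom{a+k-1}{k}$ is the number of multisets of size $k$ on $a$ elements and the sum is empty (zero) for $m\le j$. Then the linear map on $\mathcal A_{\mathrm{pk}}$ given by $$[\pi]_{\mathrm{pk}}\mapsto\begin{cases}\theta_{|\pi|,\,\mathrm{pk}\,\pi}, & |\pi|\ge1,\\ 1\ (\text{the constant function}), & |\pi|=0,\end{cases}$$ is a $\mathbb Q$-algebra isomorphism from $\mathcal A_{\mathrm{pk}}$ onto the span of $\{1\}\cup\{\theta_{n,j}: n\ge1,\ 0\le j\le\lfloor (n-1)/2\rfloor\}$, which is a subalgebra of $\mathbb Q[x]^{\mathbb N}$, the algebra of functions $\mathbb N\to\mathbb Q[x]$ with pointwise operations. -/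

import Mathlib

open scoped Polynomial

/-- A linear permutation: a word in the positive integers in which no letter is repeated,
i.e. an arrangement of a finite set of positive integers (the empty word is allowed). -/
abbrev LinPerm : Type := {w : List ℕ+ // w.Nodup}

namespace LinPerm

/-- The length `|w|`. -/
def len (w : LinPerm) : ℕ := w.1.length

/-- The `i`-th letter `w_i` of `w`, for `1 ≤ i ≤ |w|` (positions start at `1`; the value outside
this range is irrelevant). -/
def letter (w : LinPerm) (i : ℕ) : ℕ+ := w.1.getD (i - 1) 1

/-- The peak set `{i ∈ [2, |w| - 1] : w_{i-1} < w_i > w_{i+1}}`. -/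
def Pk (w : LinPerm) : Finset ℕ :=
  {i ∈ Finset.Icc 2 (w.len - 1) | w.letter (i - 1) < w.letter i ∧ w.letter (i + 1) < w.letter i}

/-- The peak number. -/
def pk (w : LinPerm) : ℕ := w.Pk.card

/-- Two linear permutations are disjoint if they have no letter in common. -/
def Disj (π σ : LinPerm) : Prop := ∀ a ∈ π.1, a ∉ σ.1

/-- The shuffle set of `π` and `σ`, as a set. -/
def shuffleSet (π σ : LinPerm) : Set LinPerm :=
  {τ | τ.len = π.len + σ.len ∧ π.1.Sublist τ.1 ∧ σ.1.Sublist τ.1}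

theorem Disj.symm {π σ : LinPerm} (h : Disj π σ) : Disj σ π := fun a ha hb => h a hb ha

theorem perm_of_mem_shuffleSet {π σ τ : LinPerm} (h : Disj π σ) (hτ : τ ∈ shuffleSet π σ) :
    τ.1.Perm (π.1 ++ σ.1) := by
  obtain ⟨hl, h1, h2⟩ := hτ
  have hnd : (π.1 ++ σ.1).Nodup :=
    List.nodup_append'.2 ⟨π.2, σ.2, fun a ha hb => h a ha hb⟩
  have hsub : (π.1 ++ σ.1) ⊆ τ.1 := by
    intro a ha
    rcases List.mem_append.1 ha with ha | ha
    · exact h1.subset ha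
    · exact h2.subset ha
  refine ((List.subperm_of_subset hnd hsub).perm_of_length_le ?_).symm
  simp only [List.length_append]
  exact hl.le

theorem shuffleSet_finite {π σ : LinPerm} (h : Disj π σ) : (shuffleSet π σ).Finite := by
  refine Set.Finite.of_finite_image (f := Subtype.val) ?_ Subtype.val_injective.injOn
  refine Set.Finite.subset (List.finite_toSet (π.1 ++ σ.1).permutations) ?_
  rintro _ ⟨τ, hτ, rfl⟩
  exact List.mem_permutations.2 (perm_of_mem_shuffleSet h hτ)

/-- The shuffle set of two disjoint linear permutations, as a finite set. -/
noncomputable def shuffle (π σ : LinPerm) (h : Disj π σ) : Finset LinPerm :=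
  (shuffleSet_finite h).toFinset

theorem mem_shuffle {π σ τ : LinPerm} {h : Disj π σ} :
    τ ∈ shuffle π σ h ↔ τ.len = π.len + σ.len ∧ π.1.Sublist τ.1 ∧ σ.1.Sublist τ.1 :=
  Set.Finite.mem_toFinset _

end LinPerm

open LinPerm in
/-- A statistic `st` is shuffle compatible if, for disjoint `π` and `σ`, the multiset of the values
`st τ`, `τ` in the shuffle set of `π` and `σ`, depends only on `st π`, `st σ`, `|π|`, `|σ|`. -/
def ShuffleCompatible {β : Type*} (st : LinPerm → β) : Prop :=
  ∀ (π σ π' σ' : LinPerm) (h : Disj π σ) (h' : Disj π' σ'),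
    st π = st π' → st σ = st σ' → π.len = π'.len → σ.len = σ'.len →
      (shuffle π σ h).val.map st = (shuffle π' σ' h').val.map st

namespace LinPerm

/-- `st`-equivalence of linear permutations. -/
def statSetoid {β : Type*} (st : LinPerm → β) : Setoid LinPerm where
  r π σ := st π = st σ ∧ π.len = σ.len
  iseqv := ⟨fun _ => ⟨rfl, rfl⟩, fun h => ⟨h.1.symm, h.2.symm⟩,
    fun h h' => ⟨h.1.trans h'.1, h.2.trans h'.2⟩⟩

/-- The set of `pk`-equivalence classes. -/
abbrev PkClass : Type := Quotient (statSetoid pk)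

/-- The class `[π]_pk`. -/
def toClass (π : LinPerm) : PkClass := Quotient.mk (statSetoid pk) π

theorem toClass_eq_iff {π σ : LinPerm} :
    toClass π = toClass σ ↔ pk π = pk σ ∧ π.len = σ.len :=
  Quotient.eq (r := statSetoid pk)

/-- The permutation obtained by adding `N` to all letters. -/
def shift (N : ℕ+) (π : LinPerm) : LinPerm :=
  ⟨π.1.map (· + N), π.2.map (add_left_injective N)⟩

theorem toClass_shift (N : ℕ+) (π : LinPerm) : toClass (shift N π) = toClass π := by
  have hl : (shift N π).len = π.len := by simp [shift, len]
  refine toClass_eq_iff.2 ⟨?_, hl⟩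
  have hlet : ∀ i, 1 ≤ i → i ≤ π.len → (shift N π).letter i = π.letter i + N := by
    intro i hi hi'
    have : i - 1 < π.1.length := by unfold len at hi'; omega
    simp [letter, shift, List.getD, this]
  unfold pk Pk
  rw [hl]
  congr 1
  refine Finset.filter_congr fun i hi => ?_
  rw [Finset.mem_Icc] at hi
  rw [hlet i (by omega) (by omega), hlet (i - 1) (by omega) (by omega),
    hlet (i + 1) (by omega) (by omega)]
  simp

theorem exists_shift_disj (l : List ℕ+) (π : LinPerm) :
    ∃ σ : LinPerm, toClass σ = toClass π ∧ ∀ a ∈ σ.1, a ∉ l := by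
  obtain ⟨N, hN⟩ : ∃ N : ℕ+, ∀ a ∈ l, a ≤ N := by
    obtain ⟨N, hN⟩ := l.toFinset.bddAbove
    exact ⟨N, fun a ha => hN (by simpa using ha)⟩
  refine ⟨shift N π, toClass_shift N π, ?_⟩
  intro a ha hal
  obtain ⟨b, -, rfl⟩ := List.mem_map.1 ha
  exact absurd (hN _ hal) (not_le.2 (PNat.lt_add_left N b))

theorem exists_disj_reps (p : PkClass × PkClass) :
    ∃ q : LinPerm × LinPerm, Disj q.1 q.2 ∧ toClass q.1 = p.1 ∧ toClass q.2 = p.2 := by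
  obtain ⟨a, b⟩ := p
  induction a using Quotient.inductionOn with | _ π => ?_
  induction b using Quotient.inductionOn with | _ σ => ?_
  obtain ⟨σ', h1, h2⟩ := exists_shift_disj π.1 σ
  exact ⟨(π, σ'), fun a ha hb => h2 a hb ha, rfl, h1⟩

end LinPerm

open LinPerm

/-- The underlying vector space of the shuffle algebra `A_pk` of the peak number: the rational
vector space with basis the `pk`-equivalence classes. The argument `h` records that `pk` is shuffle
compatible, which makes the multiplication below independent of the choice of representatives. -/
def PkAlgebra (_h : ShuffleCompatible pk) : Type := PkClass →₀ ℚ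

namespace PkAlgebra

variable {h : ShuffleCompatible pk}

noncomputable instance : AddCommGroup (PkAlgebra h) :=
  inferInstanceAs (AddCommGroup (PkClass →₀ ℚ))

noncomputable instance : Module ℚ (PkAlgebra h) :=
  inferInstanceAs (Module ℚ (PkClass →₀ ℚ))

/-- The basis of `A_pk` given by the `pk`-equivalence classes. -/
noncomputable def basis (h : ShuffleCompatible pk) : Module.Basis PkClass ℚ (PkAlgebra h) :=
  Module.Basis.ofRepr (LinearEquiv.refl ℚ (PkClass →₀ ℚ))

/-- The basis element `[π]_pk` of `A_pk`. -/
noncomputable def cls (h : ShuffleCompatible pk) (π : LinPerm) : PkAlgebra h :=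
  basis h (toClass π)

/-- The multiplication of `A_pk`: the bilinear map that sends a pair of classes with disjoint
representatives `π`, `σ` to the sum of `[τ]_pk` over `τ` in the shuffle set of `π` and `σ`. -/
noncomputable def mulLin (h : ShuffleCompatible pk) :
    PkAlgebra h →ₗ[ℚ] PkAlgebra h →ₗ[ℚ] PkAlgebra h :=
  (basis h).constr ℚ fun a => (basis h).constr ℚ fun b =>
    ∑ τ ∈ shuffle _ _ (exists_disj_reps (a, b)).choose_spec.1, cls h τ

theorem sum_cls_congr {π σ π' σ' : LinPerm} (d : Disj π σ) (d' : Disj π' σ')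
    (hπ : toClass π = toClass π') (hσ : toClass σ = toClass σ') :
    ∑ τ ∈ shuffle π σ d, cls h τ = ∑ τ ∈ shuffle π' σ' d', cls h τ := by
  rw [toClass_eq_iff] at hπ hσ
  have key := h π σ π' σ' d d' hπ.1 hσ.1 hπ.2 hσ.2
  let f : PkClass → ℕ × ℕ := fun c => Quotient.liftOn c
    (fun w : LinPerm => (w.pk, w.len)) (fun _ _ e => Prod.ext e.1 e.2)
  have hf : Function.Injective f := by
    intro a b
    induction a using Quotient.inductionOn with | _ π => ?_
    induction b using Quotient.inductionOn with | _ σ => ?_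
    intro e
    exact toClass_eq_iff.2 ⟨congrArg Prod.fst e, congrArg Prod.snd e⟩
  have aux : ∀ (n : ℕ) (s : Finset LinPerm), (∀ τ ∈ s, τ.len = n) →
      (s.val.map toClass).map f = (s.val.map pk).map (fun k => (k, n)) := by
    intro n s hs
    rw [Multiset.map_map, Multiset.map_map]
    exact Multiset.map_congr rfl fun τ hτ => Prod.ext rfl (hs τ hτ)
  have e : (shuffle π σ d).val.map toClass = (shuffle π' σ' d').val.map toClass := by
    apply Multiset.map_injective hf
    rw [aux (π.len + σ.len) _ fun τ hτ => (mem_shuffle.1 hτ).1,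
      aux (π.len + σ.len) (shuffle π' σ' d')
        (fun τ hτ => by rw [(mem_shuffle.1 hτ).1, hπ.2, hσ.2]), key]
  have e' := congrArg (fun s => (s.map (basis h)).sum) e
  simp only [Multiset.map_map] at e'
  exact e'

noncomputable instance : Mul (PkAlgebra h) := ⟨fun x y => mulLin h x y⟩

/-- The defining property of the multiplication of `A_pk`. -/
theorem cls_mul_cls {π σ : LinPerm} (d : Disj π σ) :
    cls h π * cls h σ = ∑ τ ∈ shuffle π σ d, cls h τ := by
  change mulLin h (cls h π) (cls h σ) = _
  have hs := (exists_disj_reps (toClass π, toClass σ)).choose_spec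
  rw [mulLin, cls, cls, Module.Basis.constr_basis, Module.Basis.constr_basis]
  exact sum_cls_congr _ d hs.2.1 hs.2.2

/-- The unit of `A_pk` is the class of the empty permutation. -/
noncomputable instance : One (PkAlgebra h) := ⟨cls h ⟨[], List.nodup_nil⟩⟩

noncomputable instance : NonUnitalNonAssocRing (PkAlgebra h) where
  left_distrib x y z := map_add (mulLin h x) y z
  right_distrib x y z := by
    change mulLin h (x + y) z = mulLin h x z + mulLin h y z
    rw [map_add, LinearMap.add_apply]
  zero_mul x := by
    change mulLin h 0 x = 0
    rw [map_zero, LinearMap.zero_apply]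
  mul_zero x := map_zero (mulLin h x)

theorem smul_mul' (r : ℚ) (x y : PkAlgebra h) : (r • x) * y = r • (x * y) := by
  change mulLin h (r • x) y = r • mulLin h x y
  rw [map_smul, LinearMap.smul_apply]

theorem mul_smul' (r : ℚ) (x y : PkAlgebra h) : x * (r • y) = r • (x * y) :=
  map_smul (mulLin h x) r y

theorem induction_cls {P : PkAlgebra h → Prop} (l : List ℕ+) (x : PkAlgebra h)
    (hcls : ∀ π : LinPerm, (∀ a ∈ π.1, a ∉ l) → P (cls h π)) (h0 : P 0)
    (hadd : ∀ x y, P x → P y → P (x + y)) (hsmul : ∀ (r : ℚ) x, P x → P (r • x)) : P x := by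
  refine Submodule.span_induction (p := fun x _ => P x) ?_ h0 (fun x y _ _ => hadd x y)
    (fun r x _ => hsmul r x) ((basis h).mem_span x)
  rintro _ ⟨c, rfl⟩
  induction c using Quotient.inductionOn with | _ π => ?_
  obtain ⟨σ, h1, h2⟩ := exists_shift_disj l π
  have := hcls σ h2
  rwa [cls, h1] at this

theorem one_mul_cls (π : LinPerm) : (1 : PkAlgebra h) * cls h π = cls h π := by
  have d : Disj ⟨[], List.nodup_nil⟩ π := fun a ha => by simp at ha
  refine (cls_mul_cls d).trans ?_
  have : shuffle _ _ d = {π} := by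
    ext τ
    rw [mem_shuffle, Finset.mem_singleton]
    constructor
    · rintro ⟨h1, -, h3⟩
      exact Subtype.ext (h3.eq_of_length (by simpa [len] using h1.symm)).symm
    · rintro rfl
      exact ⟨by simp [len], List.nil_sublist _, List.Sublist.refl _⟩
  rw [this, Finset.sum_singleton]

theorem mul_comm' (x y : PkAlgebra h) : x * y = y * x := by
  induction x using induction_cls [] with
  | h0 => rw [zero_mul, mul_zero]
  | hadd a b ha hb => rw [add_mul, mul_add, ha, hb]
  | hsmul r a ha => rw [smul_mul', mul_smul', ha]
  | hcls π _ =>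
  induction y using induction_cls π.1 with
  | h0 => rw [zero_mul, mul_zero]
  | hadd a b ha hb => rw [add_mul, mul_add, ha, hb]
  | hsmul r a ha => rw [smul_mul', mul_smul', ha]
  | hcls σ hσ =>
  have d : Disj σ π := hσ
  rw [cls_mul_cls d, cls_mul_cls d.symm]
  refine Finset.sum_congr ?_ fun _ _ => rfl
  ext τ
  rw [mem_shuffle, mem_shuffle, add_comm, and_comm (a := π.1.Sublist τ.1)]

theorem mem_or_mem {π σ ρ : LinPerm} (d : Disj π σ) (hρ : ρ ∈ shuffle π σ d) (a : ℕ+) :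
    a ∈ ρ.1 ↔ a ∈ π.1 ∨ a ∈ σ.1 := by
  rw [(perm_of_mem_shuffleSet d (mem_shuffle.1 hρ)).mem_iff, List.mem_append]

theorem eq_filter_of_sublist {ρ υ : List ℕ+} (hυ : υ.Nodup) (hs : ρ.Sublist υ) :
    ρ = υ.filter (fun a => a ∈ ρ) := by
  have h1 := hs.filter (fun a => a ∈ ρ)
  rw [List.filter_eq_self.2 (fun a ha => by simpa using ha)] at h1
  refine h1.eq_of_length_le ?_
  refine (List.subperm_of_subset (hυ.filter _) fun a ha => ?_).length_le
  simpa using (List.mem_filter.1 ha).2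

/-- The product of three classes with pairwise disjoint representatives. -/
theorem mul_cls_assoc_aux {π σ τ : LinPerm} (d : Disj π σ) (d1 : Disj π τ) (d2 : Disj σ τ)
    (s : Finset LinPerm) (hs : ∀ υ, υ ∈ s ↔ υ.len = π.len + σ.len + τ.len ∧
      π.1.Sublist υ.1 ∧ σ.1.Sublist υ.1 ∧ τ.1.Sublist υ.1) :
    cls h π * cls h σ * cls h τ = ∑ υ ∈ s, cls h υ := by
  classical
  have d3 : ∀ ρ ∈ shuffle π σ d, Disj ρ τ := by
    intro ρ hρ a ha
    rcases (mem_or_mem d hρ a).1 ha with ha | ha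
    · exact d1 a ha
    · exact d2 a ha
  rw [cls_mul_cls d, Finset.sum_mul, ← Finset.sum_attach]
  rw [Finset.sum_congr rfl fun ρ _ => cls_mul_cls (h := h) (d3 ρ.1 ρ.2), Finset.sum_sigma']
  refine Finset.sum_bij (fun p _ => p.2) ?_ ?_ ?_ ?_
  · rintro ⟨⟨ρ, hρ⟩, υ⟩ hp
    have hp := mem_shuffle.1 (Finset.mem_sigma.1 hp).2
    have hρ := mem_shuffle.1 hρ
    exact (hs υ).2 ⟨by rw [hp.1, hρ.1], hρ.2.1.trans hp.2.1, hρ.2.2.trans hp.2.1, hp.2.2⟩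
  · rintro ⟨⟨ρ, hρ⟩, υ⟩ hp ⟨⟨ρ', hρ'⟩, υ'⟩ hp' e
    obtain rfl : υ = υ' := e
    have hp := mem_shuffle.1 (Finset.mem_sigma.1 hp).2
    have hp' := mem_shuffle.1 (Finset.mem_sigma.1 hp').2
    have hpm : ρ.1.Perm ρ'.1 := (List.perm_ext_iff_of_nodup ρ.2 ρ'.2).2 fun a => by
      rw [mem_or_mem d hρ, mem_or_mem d hρ']
    obtain rfl : ρ = ρ' := by
      refine Subtype.ext ?_
      rw [eq_filter_of_sublist υ.2 hp.2.1, eq_filter_of_sublist υ.2 hp'.2.1]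
      exact List.filter_congr fun a _ => decide_eq_decide.2 hpm.mem_iff
    rfl
  · intro υ hυ
    obtain ⟨hl, h1, h2, h3⟩ := (hs υ).1 hυ
    let ρ : LinPerm := ⟨υ.1.filter (fun a => a ∈ π.1 ∨ a ∈ σ.1), υ.2.filter _⟩
    have hπ : π.1.Sublist ρ.1 := by
      have := h1.filter (fun a => a ∈ π.1 ∨ a ∈ σ.1)
      rwa [List.filter_eq_self.2 (fun a ha => by simp [ha])] at this
    have hσ : σ.1.Sublist ρ.1 := by
      have := h2.filter (fun a => a ∈ π.1 ∨ a ∈ σ.1)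
      rwa [List.filter_eq_self.2 (fun a ha => by simp [ha])] at this
    have hpm : ρ.1.Perm (π.1 ++ σ.1) := by
      refine (List.perm_ext_iff_of_nodup ρ.2
        (List.nodup_append'.2 ⟨π.2, σ.2, fun a ha hb => d a ha hb⟩)).2 fun a => ?_
      constructor
      · intro ha
        simpa using (List.mem_filter.1 ha).2
      · intro ha
        rcases List.mem_append.1 ha with ha | ha
        · exact hπ.subset ha
        · exact hσ.subset ha
    have hρl : ρ.len = π.len + σ.len := by
      unfold len
      rw [hpm.length_eq, List.length_append]
    have hρ : ρ ∈ shuffle π σ d := mem_shuffle.2 ⟨hρl, hπ, hσ⟩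
    refine ⟨⟨⟨ρ, hρ⟩, υ⟩, Finset.mem_sigma.2 ⟨Finset.mem_attach _ _, mem_shuffle.2
      ⟨by rw [hl, hρl], List.filter_sublist, h3⟩⟩, rfl⟩
  · intro _ _
    rfl

theorem mul_assoc' (x y z : PkAlgebra h) : x * y * z = x * (y * z) := by
  induction x using induction_cls [] with
  | h0 => simp only [zero_mul]
  | hadd a b ha hb => simp only [add_mul, ha, hb]
  | hsmul r a ha => simp only [smul_mul', ha]
  | hcls π _ =>
  induction y using induction_cls π.1 with
  | h0 => simp only [zero_mul, mul_zero]
  | hadd a b ha hb => simp only [add_mul, mul_add, ha, hb]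
  | hsmul r a ha => simp only [smul_mul', mul_smul', ha]
  | hcls σ hσ =>
  induction z using induction_cls (π.1 ++ σ.1) with
  | h0 => simp only [mul_zero]
  | hadd a b ha hb => simp only [mul_add, ha, hb]
  | hsmul r a ha => simp only [mul_smul', ha]
  | hcls τ hτ =>
  have d : Disj σ π := hσ
  have d1 : Disj τ π := fun a ha hb => hτ a ha (List.mem_append_left _ hb)
  have d2 : Disj τ σ := fun a ha hb => hτ a ha (List.mem_append_right _ hb)
  have hfin : {υ : LinPerm | υ.len = π.len + σ.len + τ.len ∧
      π.1.Sublist υ.1 ∧ σ.1.Sublist υ.1 ∧ τ.1.Sublist υ.1}.Finite := by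
    refine Set.Finite.of_finite_image (f := Subtype.val) ?_ Subtype.val_injective.injOn
    refine Set.Finite.subset (List.finite_toSet (π.1 ++ σ.1 ++ τ.1).permutations) ?_
    rintro _ ⟨υ, ⟨hl, h1, h2, h3⟩, rfl⟩
    have hnd : (π.1 ++ σ.1 ++ τ.1).Nodup :=
      List.nodup_append'.2 ⟨List.nodup_append'.2 ⟨π.2, σ.2, fun a ha hb => d a hb ha⟩, τ.2,
        fun a ha hb => hτ a hb ha⟩
    have hsub : (π.1 ++ σ.1 ++ τ.1) ⊆ υ.1 := by
      intro a ha
      rcases List.mem_append.1 ha with ha | ha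
      · rcases List.mem_append.1 ha with ha | ha
        · exact h1.subset ha
        · exact h2.subset ha
      · exact h3.subset ha
    refine List.mem_permutations.2 ((List.subperm_of_subset hnd hsub).perm_of_length_le ?_).symm
    simp only [List.length_append]
    exact hl.le
  rw [mul_comm' (cls h π) (cls h σ * cls h τ),
    mul_cls_assoc_aux d.symm d1.symm d2.symm hfin.toFinset,
    mul_cls_assoc_aux d2.symm d d1 hfin.toFinset]
  · intro υ
    rw [Set.Finite.mem_toFinset, Set.mem_ofPred_eq]
    constructor
    · rintro ⟨h1, h2, h3, h4⟩
      exact ⟨by omega, h3, h4, h2⟩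
    · rintro ⟨h1, h2, h3, h4⟩
      exact ⟨by omega, h4, h2, h3⟩
  · intro υ
    rw [Set.Finite.mem_toFinset, Set.mem_ofPred_eq]

noncomputable instance : CommRing (PkAlgebra h) where
  mul_assoc := mul_assoc'
  mul_comm := mul_comm'
  one_mul x := by
    induction x using induction_cls [] with
    | h0 => rw [mul_zero]
    | hadd a b ha hb => rw [mul_add, ha, hb]
    | hsmul r a ha => rw [mul_smul', ha]
    | hcls π _ => exact one_mul_cls π
  mul_one x := by
    rw [mul_comm']
    induction x using induction_cls [] with
    | h0 => rw [mul_zero]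
    | hadd a b ha hb => rw [mul_add, ha, hb]
    | hsmul r a ha => rw [mul_smul', ha]
    | hcls π _ => exact one_mul_cls π

noncomputable instance : Algebra ℚ (PkAlgebra h) :=
  Algebra.ofModule smul_mul' mul_smul'

end PkAlgebra

/-- The function `m ↦ 2^{2j+1} ∑_{k=0}^{m-1-j} ((n+1 multichoose k)) C(n-2j-1, m-1-j-k) x^n` from
`ℕ` to `ℚ[x]`, for `n ≥ 1` and `2j + 1 ≤ n`; the sum is empty if `m ≤ j`. -/
noncomputable def peakFun (n j : ℕ) : ℕ → ℚ[X] := fun m =>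
  Polynomial.monomial n (2 ^ (2 * j + 1) * ∑ k ∈ Finset.range (m - j),
    ((n + 1).multichoose k : ℚ) * ((n - 2 * j - 1).choose (m - 1 - j - k) : ℚ))

/-- The image of `[π]_pk`: `1` for the empty permutation, `peakFun |π| (pk π)` otherwise. -/
noncomputable def peakImage (π : LinPerm) : ℕ → ℚ[X] :=
  if π.len = 0 then 1 else peakFun π.len π.pk

/-! For fixed `m`, the coefficient of `x^n` in the image of a permutation counts enriched partitions
with parts of absolute value at most `m`: it is the number of ways to cut the word into `2m`
possibly empty factors, alternately decreasing and increasing. This count, `ordPoly m`, explains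
both halves of the theorem.

Multiplicativity. Two disjoint increasing words have exactly one increasing shuffle, so the
indicator of increasing words turns sums over shuffles into products (`isShuffleChar_chain`);
likewise for decreasing words. Cutting a shuffle amounts to cutting both words and shuffling the
pieces (`shuffleSum_conv`), so the property passes to convolutions, hence to `ordPoly m`.

Dependence on length and peaks only. The generating function in `m` is computed by peeling letters
off the front. A single letter gives `2X/(1-X)^2`, each further letter a factor `(1+X)/(1-X)`,
except that each peak replaces two such factors by `4X/(1-X)^2` (`gf_eq`). Taking coefficients
yields the stated formula (`ordPoly_eq`).

In each degree the functions are triangular in the number of peaks, hence linearly independent.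
Independence gives injectivity and also shuffle compatibility itself: the product of two images
determines the formal sum of classes over the shuffles, and so the multiset of peak numbers. -/

namespace PeakShuffle

/-! ### Shuffles of words and deconcatenation. -/

variable {α R : Type*}

/-- The list of all shuffles of two words. -/
def shuffles : List α → List α → List (List α)
  | [], v => [v]
  | a :: u, [] => [a :: u]
  | a :: u, b :: v =>
    (shuffles u (b :: v)).map (a :: ·) ++ (shuffles (a :: u) v).map (b :: ·)
termination_by u v => u.length + v.length

theorem shuffles_nil_right (u : List α) : shuffles u [] = [u] := by
  cases u <;> simp [shuffles]

/-- The sum of the values of `f` on the shuffles of `u` and `v`. -/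
def shuffleSum [AddCommMonoid R] (f : List α → R) (u v : List α) : R :=
  ((shuffles u v).map f).sum

section shuffleSum

variable [CommSemiring R]

theorem shuffleSum_nil_left (f : List α → R) (v : List α) : shuffleSum f [] v = f v := by
  simp [shuffleSum, shuffles]

theorem shuffleSum_nil_right (f : List α → R) (u : List α) : shuffleSum f u [] = f u := by
  simp [shuffleSum, shuffles_nil_right]

theorem shuffleSum_cons_cons (f : List α → R) (a b : α) (u v : List α) :
    shuffleSum f (a :: u) (b :: v) =
      shuffleSum (fun w => f (a :: w)) u (b :: v) +
        shuffleSum (fun w => f (b :: w)) (a :: u) v := by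
  simp [shuffleSum, shuffles, Function.comp_def]

theorem shuffleSum_add (f g : List α → R) (u v : List α) :
    shuffleSum (fun w => f w + g w) u v = shuffleSum f u v + shuffleSum g u v :=
  List.sum_map_add

theorem shuffleSum_const_mul (c : R) (f : List α → R) (u v : List α) :
    shuffleSum (fun w => c * f w) u v = c * shuffleSum f u v :=
  List.sum_map_mul_left ..

theorem shuffleSum_congr {f g : List α → R} {u v : List α}
    (h : ∀ w ∈ shuffles u v, f w = g w) : shuffleSum f u v = shuffleSum g u v := by
  rw [shuffleSum, List.map_congr_left h, shuffleSum]

/-- The convolution of two functions on words with respect to deconcatenation. -/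
def conv (f g : List α → R) (w : List α) : R :=
  ∑ i ∈ Finset.range (w.length + 1), f (w.take i) * g (w.drop i)

theorem conv_nil (f g : List α → R) : conv f g [] = f [] * g [] := by
  simp [conv]

theorem conv_cons (f g : List α → R) (a : α) (w : List α) :
    conv f g (a :: w) = f [] * g (a :: w) + conv (fun w => f (a :: w)) g w := by
  rw [conv, conv, List.length_cons, Finset.sum_range_succ', add_comm]
  simp

/-- Every cut of a shuffle arises from a unique pair of cuts of `u` and `v`, with shuffles of the
two prefixes and of the two suffixes. The induction varies `g`, because removing the first letter
`a` replaces `g` by `g (a :: ·)`. -/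
theorem shuffleSum_conv (g f : List α → R) (u v : List α) :
    shuffleSum (conv g f) u v =
      ∑ i ∈ Finset.range (u.length + 1), ∑ j ∈ Finset.range (v.length + 1),
        shuffleSum g (u.take i) (v.take j) * shuffleSum f (u.drop i) (v.drop j) := by
  induction u, v using shuffles.induct generalizing g with
  | case1 v => simp [shuffleSum_nil_left, conv]
  | case2 a u => simp [shuffleSum_nil_right, conv]
  | case3 a u b v ih1 ih2 =>
    rw [shuffleSum_cons_cons]
    simp only [conv_cons, shuffleSum_add, shuffleSum_const_mul]
    rw [ih1, ih2]
    simp only [List.length_cons, Finset.sum_range_succ' _ (_ + 1), List.take_succ_cons,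
      List.drop_succ_cons, List.take_zero, List.drop_zero, shuffleSum_cons_cons,
      shuffleSum_nil_left, shuffleSum_nil_right, Finset.sum_add_distrib, add_mul, mul_add]
    ring

end shuffleSum

/-! ### The recursive list of shuffles against the shuffle set of permutations. -/

theorem perm_of_mem_shuffles {u v w : List α} (h : w ∈ shuffles u v) : w.Perm (u ++ v) := by
  induction u, v using shuffles.induct generalizing w with
  | case1 v => simp_all [shuffles]
  | case2 a u => simp_all [shuffles]
  | case3 a u b v ih1 ih2 =>
    rw [shuffles, List.mem_append, List.mem_map, List.mem_map] at h
    obtain ⟨x, hx, rfl⟩ | ⟨x, hx, rfl⟩ := h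
    · exact (ih1 hx).cons a
    · exact ((ih2 hx).cons b).trans List.perm_middle.symm

theorem sublist_of_mem_shuffles {u v w : List α} (h : w ∈ shuffles u v) :
    u.Sublist w ∧ v.Sublist w := by
  induction u, v using shuffles.induct generalizing w with
  | case1 v => simp_all [shuffles]
  | case2 a u => simp_all [shuffles]
  | case3 a u b v ih1 ih2 =>
    rw [shuffles, List.mem_append, List.mem_map, List.mem_map] at h
    obtain ⟨x, hx, rfl⟩ | ⟨x, hx, rfl⟩ := h
    · exact ⟨(ih1 hx).1.cons_cons a, (ih1 hx).2.cons a⟩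
    · exact ⟨(ih2 hx).1.cons b, (ih2 hx).2.cons_cons b⟩

theorem cons_mem_shuffles_left {a : α} {u v w : List α} (h : w ∈ shuffles u v) :
    a :: w ∈ shuffles (a :: u) v := by
  cases v with
  | nil => simpa [shuffles_nil_right] using h
  | cons b v =>
    rw [shuffles]
    exact List.mem_append_left _ (List.mem_map_of_mem h)

theorem cons_mem_shuffles_right {b : α} {u v w : List α} (h : w ∈ shuffles u v) :
    b :: w ∈ shuffles u (b :: v) := by
  cases u with
  | nil => simpa [shuffles] using h
  | cons a u =>
    rw [shuffles]
    exact List.mem_append_right _ (List.mem_map_of_mem h)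

theorem mem_shuffles {u v w : List α} (hw : w.Nodup) (d : u.Disjoint v)
    (hl : w.length = u.length + v.length) (hu : u.Sublist w) (hv : v.Sublist w) :
    w ∈ shuffles u v := by
  induction w generalizing u v with
  | nil =>
    rw [List.sublist_nil.1 hu, List.sublist_nil.1 hv]
    simp [shuffles]
  | cons c w ih =>
    rw [List.nodup_cons] at hw
    have key : ∀ {x y : List α}, (c :: x).Sublist (c :: w) →
        y.Sublist (c :: w) → c ∉ y → x.Sublist w ∧ y.Sublist w := by
      intro x y hx hy hc
      refine ⟨List.cons_sublist_cons.1 hx, ?_⟩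
      rcases List.sublist_cons_iff.1 hy with h | ⟨r, rfl, -⟩
      · exact h
      · simp at hc
    rcases List.sublist_cons_iff.1 hu with h | ⟨r, rfl, -⟩
    · rcases List.sublist_cons_iff.1 hv with h' | ⟨r, rfl, -⟩
      -- If neither word uses the first letter `c`, all letters of `u` and `v` lie in the shorter
      -- word `w`, which contradicts the length.
      · have hnd : (u ++ v).Nodup :=
          List.nodup_append'.2 ⟨hw.2.sublist h, hw.2.sublist h', d⟩
        have hsub : u ++ v ⊆ w := by
          intro x hx
          rcases List.mem_append.1 hx with hx | hx
          · exact h.subset hx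
          · exact h'.subset hx
        have := (List.subperm_of_subset hnd hsub).length_le
        simp only [List.length_append, List.length_cons] at this hl
        omega
      · have hd : u.Disjoint r := fun x hx hy => d hx (List.mem_cons_of_mem _ hy)
        obtain ⟨h1, h2⟩ := key hv hu fun hc => d hc List.mem_cons_self
        refine cons_mem_shuffles_right (ih hw.2 hd ?_ h2 h1)
        simp only [List.length_cons] at hl
        omega
    · have hd : r.Disjoint v := fun x hx hy => d (List.mem_cons_of_mem _ hx) hy
      obtain ⟨h1, h2⟩ := key hu hv fun hc => d List.mem_cons_self hc
      refine cons_mem_shuffles_left (ih hw.2 hd ?_ h1 h2)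
      simp only [List.length_cons] at hl
      omega

theorem nodup_shuffles {u v : List α} (d : u.Disjoint v) : (shuffles u v).Nodup := by
  induction u, v using shuffles.induct with
  | case1 v => simp [shuffles]
  | case2 a u => simp [shuffles]
  | case3 a u b v ih1 ih2 =>
    rw [shuffles, List.nodup_append']
    refine ⟨(ih1 fun x hx => d (List.mem_cons_of_mem _ hx)).map (List.cons_injective),
      (ih2 fun x hx hy => d hx (List.mem_cons_of_mem _ hy)).map (List.cons_injective), ?_⟩
    intro x hx hy
    obtain ⟨y, -, rfl⟩ := List.mem_map.1 hx
    obtain ⟨z, -, h⟩ := List.mem_map.1 hy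
    injection h with h
    exact d (a := a) List.mem_cons_self (h ▸ List.mem_cons_self)

/-- The sum over the shuffle set of two disjoint permutations, in terms of words. -/
theorem sum_shuffle [AddCommMonoid R] {π σ : LinPerm} (d : Disj π σ) (f : List ℕ+ → R) :
    ∑ τ ∈ shuffle π σ d, f τ.1 = shuffleSum f π.1 σ.1 := by
  classical
  have hd : π.1.Disjoint σ.1 := fun a ha hb => d a ha hb
  rw [shuffleSum, ← List.sum_toFinset f (nodup_shuffles hd)]
  refine Finset.sum_bij (fun τ _ => τ.1) ?_ (fun _ _ _ _ e => Subtype.ext e) ?_ fun _ _ => rfl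
  · intro τ hτ
    obtain ⟨h1, h2, h3⟩ := mem_shuffle.1 hτ
    exact List.mem_toFinset.2 (mem_shuffles τ.2 hd h1 h2 h3)
  · intro w hw
    have hw := List.mem_toFinset.1 hw
    have hp := perm_of_mem_shuffles hw
    refine ⟨⟨w, hp.nodup_iff.2 (List.nodup_append'.2 ⟨π.2, σ.2, hd⟩)⟩, mem_shuffle.2
      ⟨?_, sublist_of_mem_shuffles hw⟩, rfl⟩
    simpa [len] using hp.length_eq

/-! ### Shuffle characters. -/

/-- A function on words is a shuffle character if its sum over the shuffles of two words without
common letters is the product of its values on these words. -/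
def IsShuffleChar [CommSemiring R] (f : List α → R) : Prop :=
  ∀ u v : List α, u.Disjoint v → shuffleSum f u v = f u * f v

theorem IsShuffleChar.conv [CommSemiring R] {g f : List α → R} (hg : IsShuffleChar g)
    (hf : IsShuffleChar f) : IsShuffleChar (conv g f) := by
  intro u v d
  rw [shuffleSum_conv, PeakShuffle.conv, PeakShuffle.conv, Finset.sum_mul_sum]
  refine Finset.sum_congr rfl fun i _ => Finset.sum_congr rfl fun j _ => ?_
  rw [hg _ _ fun x hx hy => d (List.mem_of_mem_take hx) (List.mem_of_mem_take hy),
    hf _ _ fun x hx hy => d (List.mem_of_mem_drop hx) (List.mem_of_mem_drop hy)]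
  ring

open Classical in
/-- The indicator function of the words that are increasing with respect to `r`. -/
noncomputable def chain (r : α → α → Prop) (w : List α) : ℚ := if w.Pairwise r then 1 else 0

theorem chain_nil (r : α → α → Prop) : chain r [] = 1 := by simp [chain]

theorem chain_singleton (r : α → α → Prop) (a : α) : chain r [a] = 1 := by simp [chain]

theorem chain_cons_of_forall {r : α → α → Prop} {a : α} {w : List α} (h : ∀ b ∈ w, r a b) :
    chain r (a :: w) = chain r w := by
  simp only [chain, List.pairwise_cons]
  congr 1
  simpa using fun _ => h

theorem chain_cons_of_not {r : α → α → Prop} {a b : α} {w : List α} (hb : b ∈ w) (h : ¬ r a b) :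
    chain r (a :: w) = 0 :=
  if_neg fun hw => h ((List.pairwise_cons.1 hw).1 b hb)

theorem chain_cons_cons {r : α → α → Prop} [IsTrans α r] {a b : α} (w : List α) (h : r a b) :
    chain r (a :: b :: w) = chain r (b :: w) := by
  by_cases hw : (b :: w).Pairwise r
  · refine chain_cons_of_forall fun c hc => ?_
    rcases List.mem_cons.1 hc with rfl | hc
    · exact h
    · exact _root_.trans h ((List.pairwise_cons.1 hw).1 c hc)
  · rw [chain, chain, if_neg hw, if_neg fun h' => hw (List.pairwise_cons.1 h').2]

theorem shuffleSum_eq_zero [CommSemiring R] {f : List α → R} {u v : List α}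
    (h : ∀ w ∈ shuffles u v, f w = 0) : shuffleSum f u v = 0 := by
  rw [shuffleSum]
  refine List.sum_eq_zero fun x hx => ?_
  obtain ⟨w, hw, rfl⟩ := List.mem_map.1 hx
  exact h w hw

/-- The shuffles of `a :: u` and `b :: v` that start with `a`, where `r a b`. -/
theorem shuffleSum_chain_cons {r : α → α → Prop} [IsTrans α r] {a b : α} {u v : List α}
    (h : r a b) (ih : shuffleSum (chain r) u (b :: v) = chain r u * chain r (b :: v)) :
    shuffleSum (fun w => chain r (a :: w)) u (b :: v) =
      chain r (a :: u) * chain r (b :: v) := by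
  by_cases hu : ∀ c ∈ u, r a c
  · by_cases hv : (b :: v).Pairwise r
    · rw [chain_cons_of_forall hu, ← ih]
      refine shuffleSum_congr fun w hw => chain_cons_of_forall fun c hc => ?_
      rcases List.mem_append.1 ((perm_of_mem_shuffles hw).mem_iff.1 hc) with hc | hc
      · exact hu c hc
      rcases List.mem_cons.1 hc with rfl | hc
      · exact h
      · exact _root_.trans h ((List.pairwise_cons.1 hv).1 c hc)
    · have h0 : chain r (b :: v) = 0 := if_neg hv
      rw [h0, mul_zero]
      refine shuffleSum_eq_zero fun w hw => if_neg fun h' => hv ?_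
      exact (List.pairwise_cons.1 h').2.sublist (sublist_of_mem_shuffles hw).2
  · push Not at hu
    obtain ⟨c, hc, hac⟩ := hu
    rw [chain_cons_of_not hc hac, zero_mul]
    exact shuffleSum_eq_zero fun w hw =>
      chain_cons_of_not ((sublist_of_mem_shuffles hw).1.subset hc) hac

theorem shuffleSum_comm [CommSemiring R] (f : List α → R) (u v : List α) :
    shuffleSum f u v = shuffleSum f v u := by
  induction u, v using shuffles.induct generalizing f with
  | case1 v => rw [shuffleSum_nil_left, shuffleSum_nil_right]
  | case2 a u => rw [shuffleSum_nil_left, shuffleSum_nil_right]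
  | case3 a u b v ih1 ih2 =>
    rw [shuffleSum_cons_cons, shuffleSum_cons_cons, ih1, ih2, add_comm]

/-- The only candidate for an increasing shuffle is the sorted merge, and it exists exactly when
both words are increasing. In the induction, the shuffles that start with the larger of the two
first letters contribute zero. -/
theorem isShuffleChar_chain (r : α → α → Prop) [IsStrictTotalOrder α r] :
    IsShuffleChar (chain r) := by
  intro u v d
  induction u, v using shuffles.induct with
  | case1 v => rw [shuffleSum_nil_left, chain_nil, one_mul]
  | case2 a u => rw [shuffleSum_nil_right, chain_nil, mul_one]
  | case3 a u b v ih1 ih2 =>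
    have ih1 := ih1 fun x hx => d (List.mem_cons_of_mem _ hx)
    have ih2 := ih2 fun x hx hy => d hx (List.mem_cons_of_mem _ hy)
    have hab : a ≠ b := fun e => d (a := a) List.mem_cons_self (e ▸ List.mem_cons_self)
    have key : ∀ {x y : α} {u v : List α}, r x y →
        shuffleSum (fun w => chain r (y :: w)) (x :: u) v = 0 := fun {x y u v} hxy =>
      shuffleSum_eq_zero fun w hw => chain_cons_of_not
        ((sublist_of_mem_shuffles hw).1.subset List.mem_cons_self) (asymm hxy)
    rw [shuffleSum_cons_cons]
    rcases trichotomous_of r a b with h | h | h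
    · rw [key h, add_zero, shuffleSum_chain_cons h ih1]
    · exact absurd h hab
    · rw [shuffleSum_comm _ u, key h, zero_add, shuffleSum_comm, shuffleSum_chain_cons h, mul_comm]
      rw [shuffleSum_comm, ih2, mul_comm]

theorem conv_chain_nil {α : Type*} (r : α → α → Prop) (f : List α → ℚ) :
    conv (chain r) f [] = f [] := by
  rw [conv_nil, chain_nil, one_mul]

theorem conv_chain_singleton {α : Type*} (r : α → α → Prop) (f : List α → ℚ) (a : α) :
    conv (chain r) f [a] = f [a] + f [] := by
  rw [conv_cons, conv_nil, chain_nil, chain_singleton, one_mul, one_mul]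

/-- The first factor is empty, or it starts with `a`; in the latter case `a` can be deleted without
changing whether the factor is a chain, because `a` precedes `b`. -/
theorem conv_chain_of_rel {α : Type*} {r : α → α → Prop} [IsTrans α r] (f : List α → ℚ)
    {a b : α} (w : List α) (h : r a b) :
    conv (chain r) f (a :: b :: w) = f (a :: b :: w) + conv (chain r) f (b :: w) := by
  rw [conv_cons, conv_cons, conv_cons (chain r)]
  simp only [chain_nil, chain_singleton, chain_cons_cons _ h]
  rw [one_mul]

/-- A first factor that contains both `a` and `b` is not a chain, so only the empty factor and `[a]`
remain. -/
theorem conv_chain_of_not_rel {α : Type*} {r : α → α → Prop} (f : List α → ℚ)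
    {a b : α} (w : List α) (h : ¬ r a b) :
    conv (chain r) f (a :: b :: w) = f (a :: b :: w) + f (b :: w) := by
  rw [conv_cons, conv_cons]
  simp only [chain_nil, chain_singleton, chain_cons_of_not List.mem_cons_self h]
  simp [conv]

/-- The number of enriched `w`-partitions with parts of absolute value at most `m`: the number of
factorizations of `w` into `2m` words that are alternately decreasing and increasing. -/
noncomputable def ordPoly : ℕ → List ℕ+ → ℚ
  | 0 => fun w => if w = [] then 1 else 0
  | m + 1 => conv (chain (· > ·)) (conv (chain (· < ·)) (ordPoly m))

theorem isShuffleChar_ordPoly (m : ℕ) : IsShuffleChar (ordPoly m) := by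
  induction m with
  | zero =>
    intro u v _
    rcases u with _ | ⟨a, u⟩
    · simp [shuffleSum_nil_left, ordPoly]
    rcases v with _ | ⟨b, v⟩
    · simp [shuffleSum_nil_right, ordPoly]
    · simp [shuffleSum_cons_cons, ordPoly, shuffleSum_eq_zero]
  | succ m ih => exact (isShuffleChar_chain _).conv ((isShuffleChar_chain _).conv ih)

theorem ordPoly_nil (m : ℕ) : ordPoly m [] = 1 := by
  induction m with
  | zero => simp [ordPoly]
  | succ m ih => rw [ordPoly, conv_chain_nil, conv_chain_nil, ih]

/-! ### Generating functions in the number of factors. -/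

open PowerSeries

/-- The generating function of `ordPoly`. -/
noncomputable def gf (w : List ℕ+) : ℚ⟦X⟧ := mk fun m => ordPoly m w

/-- The generating function of the variant of `ordPoly` that allows an additional increasing
factor in front. -/
noncomputable def gfInc (w : List ℕ+) : ℚ⟦X⟧ := mk fun m => conv (chain (· < ·)) (ordPoly m) w

theorem gf_cons_eq {a : ℕ+} {w : List ℕ+} {g : ℚ⟦X⟧}
    (h : ∀ m, ordPoly (m + 1) (a :: w) = coeff m g) : gf (a :: w) = X * g := by
  ext m
  cases m with
  | zero => simp [gf, ordPoly]
  | succ m => rw [gf, coeff_mk, coeff_succ_X_mul, h]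

theorem mk_one_mul : (1 - X) * (mk 1 : ℚ⟦X⟧) = 1 := by
  rw [mul_comm, mk_one_mul_one_sub_eq_one]

/-- This lemma, `gfInc_of_gt`, `gfInc_of_lt` and the primed lemmas are the raw recursions obtained
from the shape of the first factor. They form linear systems in `gf` and `gfInc`, which the lemmas
from `gf_singleton` on solve by elimination. -/
theorem gfInc_singleton (a : ℕ+) : gfInc [a] = gf [a] + mk 1 := by
  ext m
  simp [gfInc, gf, conv_chain_singleton, ordPoly_nil]

theorem gf_singleton' (a : ℕ+) : gf [a] = X * (gfInc [a] + mk 1) :=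
  gf_cons_eq fun m => by
    simp [gfInc, ordPoly, conv_chain_singleton, conv_chain_nil, ordPoly_nil]

theorem gfInc_of_gt {a b : ℕ+} (w : List ℕ+) (h : b < a) :
    gfInc (a :: b :: w) = gf (a :: b :: w) + gf (b :: w) := by
  ext m
  simp [gfInc, gf, conv_chain_of_not_rel _ w h.asymm]

theorem gfInc_of_lt {a b : ℕ+} (w : List ℕ+) (h : a < b) :
    gfInc (a :: b :: w) = gf (a :: b :: w) + gfInc (b :: w) := by
  ext m
  simp [gfInc, gf, conv_chain_of_rel _ w h]

theorem gf_of_gt' {a b : ℕ+} (w : List ℕ+) (h : b < a) :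
    gf (a :: b :: w) = X * gfInc (a :: b :: w) + gf (b :: w) := by
  have h1 : ∀ m, ordPoly (m + 1) (a :: b :: w) =
      conv (chain (· < ·)) (ordPoly m) (a :: b :: w) + ordPoly (m + 1) (b :: w) := fun m => by
    simp only [ordPoly]
    rw [conv_chain_of_rel (r := (· > ·)) _ w h]
  ext m
  cases m with
  | zero => simp [gf, ordPoly]
  | succ m => simp [gf, gfInc, coeff_succ_X_mul, h1]

theorem gf_of_lt' {a b : ℕ+} (w : List ℕ+) (h : a < b) :
    gf (a :: b :: w) = X * (gfInc (a :: b :: w) + gfInc (b :: w)) :=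
  gf_cons_eq fun m => by
    simp [gfInc, ordPoly, conv_chain_of_not_rel (r := (· > ·)) _ w h.asymm]

theorem gf_singleton (a : ℕ+) : (1 - X) ^ 2 * gf [a] = 2 * X := by
  have h1 := gfInc_singleton a
  have h2 := gf_singleton' a
  linear_combination (1 - X) * h2 + (1 - X) * X * h1 + 2 * X * mk_one_mul

theorem two_mul_gfInc_singleton (a : ℕ+) : 2 * X * gfInc [a] = (1 + X) * gf [a] := by
  have h1 := gfInc_singleton a
  have h2 := gf_singleton' a
  linear_combination X * h1 - h2

theorem gf_of_gt {a b : ℕ+} (w : List ℕ+) (h : b < a) :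
    (1 - X) * gf (a :: b :: w) = (1 + X) * gf (b :: w) := by
  have h1 := gfInc_of_gt w h
  have h2 := gf_of_gt' w h
  linear_combination h2 + X * h1

theorem gfInc_of_gt_eq {a b : ℕ+} (w : List ℕ+) (h : b < a) :
    (1 + X) * gfInc (a :: b :: w) = 2 * gf (a :: b :: w) := by
  have h1 := gfInc_of_gt w h
  have h2 := gf_of_gt w h
  linear_combination (1 + X) * h1 - h2

theorem gf_of_lt {a b : ℕ+} (w : List ℕ+) (h : a < b) :
    (1 - X) * gf (a :: b :: w) = 2 * X * gfInc (b :: w) := by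
  have h1 := gfInc_of_lt w h
  have h2 := gf_of_lt' w h
  linear_combination h2 + X * h1

theorem gfInc_of_lt_eq {a b : ℕ+} (w : List ℕ+) (h : a < b) :
    2 * X * gfInc (a :: b :: w) = (1 + X) * gf (a :: b :: w) := by
  have h1 := gfInc_of_lt w h
  have h2 := gf_of_lt w h
  linear_combination 2 * X * h1 - h2

theorem one_add_X_ne_zero : (1 + X : ℚ⟦X⟧) ≠ 0 := by
  intro h
  simpa using congrArg (coeff 0) h

theorem gf_of_peak {a b c : ℕ+} (w : List ℕ+) (hab : a < b) (hcb : c < b) :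
    (1 - X) ^ 2 * gf (a :: b :: c :: w) = 4 * X * gf (c :: w) := by
  have h1 := gf_of_lt (c :: w) hab
  have h2 := gfInc_of_gt_eq w hcb
  have h3 := gf_of_gt w hcb
  -- After the descent, `gfInc` is known only up to the factor `1 + X`, which is cancelled in a
  -- domain.
  refine mul_left_cancel₀ one_add_X_ne_zero ?_
  linear_combination (1 + X) * (1 - X) * h1 + (1 - X) * (2 * X) * h2 + 4 * X * h3

/-! ### Peaks and the closed form. -/

/-- The number of peaks of a word. -/
def peaks : List ℕ+ → ℕ
  | a :: b :: c :: w => (if a < b ∧ c < b then 1 else 0) + peaks (b :: c :: w)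
  | _ => 0

theorem peaks_of_gt {a b : ℕ+} (w : List ℕ+) (h : b < a) :
    peaks (a :: b :: w) = peaks (b :: w) := by
  cases w with
  | nil => simp [peaks]
  | cons c w => rw [peaks, if_neg fun h' => h.asymm h'.1, zero_add]

theorem peaks_of_lt_of_lt {a b c : ℕ+} (w : List ℕ+) (h : b < c) :
    peaks (a :: b :: c :: w) = peaks (b :: c :: w) := by
  rw [peaks, if_neg fun h' => h.asymm h'.2, zero_add]

theorem peaks_of_peak {a b c : ℕ+} (w : List ℕ+) (hab : a < b) (hcb : c < b) :
    peaks (a :: b :: c :: w) = 1 + peaks (c :: w) := by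
  rw [peaks, if_pos ⟨hab, hcb⟩, peaks_of_gt w hcb]

/-- The cases follow the recursions for `gf`. A peak removes two letters at once, since the
recursion for an initial ascent leads to `gfInc` and returns to `gf` only after the next comparison;
distinct letters rule out ties. -/
theorem nonempty_word_induction {P : List ℕ+ → Prop} (single : ∀ a, P [a])
    (pair : ∀ a b, a < b → P [b] → P [a, b])
    (desc : ∀ a b w, b < a → P (b :: w) → P (a :: b :: w))
    (asc : ∀ a b c w, a < b → b < c → P (b :: c :: w) → P (a :: b :: c :: w))
    (peak : ∀ a b c w, a < b → c < b → P (c :: w) → P (a :: b :: c :: w)) :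
    ∀ w : List ℕ+, w ≠ [] → w.Nodup → P w
  | [], h, _ => absurd rfl h
  | [a], _, _ => single a
  | [a, b], _, h => by
    rcases lt_trichotomy a b with hab | rfl | hab
    · exact pair a b hab (single b)
    · simp at h
    · exact desc a b [] hab (single b)
  | a :: b :: c :: w, _, h => by
    have hb := (List.nodup_cons.1 h).2
    have hc := (List.nodup_cons.1 hb).2
    have ihb := nonempty_word_induction single pair desc asc peak (b :: c :: w) (by simp) hb
    have ihc := nonempty_word_induction single pair desc asc peak (c :: w) (by simp) hc
    rcases lt_trichotomy a b with hab | rfl | hab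
    · rcases lt_trichotomy b c with hbc | rfl | hbc
      · exact asc a b c w hab hbc ihb
      · simp at hb
      · exact peak a b c w hab hbc ihc
    · simp at h
    · exact desc a b _ hab ihb

theorem two_mul_peaks_lt {w : List ℕ+} (h0 : w ≠ []) (hw : w.Nodup) :
    2 * peaks w + 1 ≤ w.length := by
  refine nonempty_word_induction (P := fun w => 2 * peaks w + 1 ≤ w.length) ?_ ?_ ?_ ?_ ?_ w h0 hw
  · simp [peaks]
  · simp [peaks]
  · intro a b w h ih
    rw [peaks_of_gt w h]
    simp only [List.length_cons] at *
    omega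
  · intro a b c w _ h ih
    rw [peaks_of_lt_of_lt w h]
    simp only [List.length_cons] at *
    omega
  · intro a b c w h h' ih
    rw [peaks_of_peak w h h']
    simp only [List.length_cons] at *
    omega

/-- Denominators are cleared, and the extra power of `1 + X` on the left avoids the truncated
exponent `n - 2j - 1` during the induction. -/
theorem one_sub_X_pow_mul_gf {w : List ℕ+} (h0 : w ≠ []) (hw : w.Nodup) :
    (1 - X) ^ (w.length + 1) * (1 + X) ^ (2 * peaks w + 1) * gf w =
      2 ^ (2 * peaks w + 1) * X ^ (peaks w + 1) * (1 + X) ^ w.length := by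
  refine nonempty_word_induction (P := fun w =>
    (1 - X) ^ (w.length + 1) * (1 + X) ^ (2 * peaks w + 1) * gf w =
      2 ^ (2 * peaks w + 1) * X ^ (peaks w + 1) * (1 + X) ^ w.length) ?_ ?_ ?_ ?_ ?_ w h0 hw
  · intro a
    simp only [List.length_cons, List.length_nil, peaks]
    linear_combination (1 + X) * gf_singleton a
  · intro a b h ih
    have h1 := gf_of_lt [] h
    rw [two_mul_gfInc_singleton] at h1
    simp only [List.length_cons, List.length_nil, peaks] at ih ⊢
    linear_combination (1 - X) ^ 2 * (1 + X) * h1 + (1 + X) * ih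
  · intro a b w h ih
    rw [peaks_of_gt w h]
    simp only [List.length_cons] at ih ⊢
    rw [pow_succ (1 - X), pow_succ (1 + X : ℚ⟦X⟧) (w.length + 1)]
    linear_combination (1 - X) ^ (w.length + 1 + 1) * (1 + X) ^ (2 * peaks (b :: w) + 1) *
      gf_of_gt w h + (1 + X) * ih
  · intro a b c w h h' ih
    have h1 := gf_of_lt (c :: w) h
    rw [gfInc_of_lt_eq w h'] at h1
    rw [peaks_of_lt_of_lt w h']
    simp only [List.length_cons] at ih ⊢
    rw [pow_succ (1 - X), pow_succ (1 + X : ℚ⟦X⟧) (w.length + 1 + 1)]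
    linear_combination (1 - X) ^ (w.length + 1 + 1 + 1) *
      (1 + X) ^ (2 * peaks (b :: c :: w) + 1) * h1 + (1 + X) * ih
  · intro a b c w h h' ih
    have h1 := gf_of_peak w h h'
    rw [peaks_of_peak w h h']
    generalize peaks (c :: w) = j at ih ⊢
    simp only [List.length_cons] at ih ⊢
    have e : 2 * (1 + j) + 1 = 2 * j + 1 + 2 := by ring
    have e' : 1 + j + 1 = j + 1 + 1 := by ring
    rw [e, e', pow_add (1 + X : ℚ⟦X⟧) (2 * j + 1) 2, pow_add (2 : ℚ⟦X⟧) (2 * j + 1) 2,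
      pow_succ (X : ℚ⟦X⟧) (j + 1)]
    linear_combination (1 - X) ^ (w.length + 1 + 1) *
      (1 + X) ^ (2 * j + 1) * (1 + X) ^ 2 * h1 + 4 * X * (1 + X) ^ 2 * ih

theorem gf_eq {w : List ℕ+} (h0 : w ≠ []) (hw : w.Nodup) :
    gf w = 2 ^ (2 * peaks w + 1) * (X ^ (peaks w + 1) *
      ((mk fun k => ((w.length + 1).multichoose k : ℚ)) *
        (1 + X) ^ (w.length - 2 * peaks w - 1))) := by
  have h1 := one_sub_X_pow_mul_gf h0 hw
  have hl := two_mul_peaks_lt h0 hw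
  -- The multichoose series is the expansion of `(1-X)^(-(n+1))`.
  have hB : (1 - X) ^ (w.length + 1) *
      (mk fun k => ((w.length + 1).multichoose k : ℚ)) = 1 := by
    have : (mk fun k => ((w.length + 1).multichoose k : ℚ)) = (mk 1) ^ (w.length + 1) := by
      rw [mk_one_pow_eq_mk_choose_add]
      ext k
      rw [coeff_mk, coeff_mk, Nat.multichoose_eq]
      congr 1
      rw [show w.length + 1 + k - 1 = w.length + k by omega, Nat.choose_symm_add]
    rw [this, ← mul_pow, mk_one_mul, one_pow]
  have hp : (1 + X : ℚ⟦X⟧) ^ w.length =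
      (1 + X) ^ (2 * peaks w + 1) * (1 + X) ^ (w.length - 2 * peaks w - 1) := by
    rw [← pow_add]
    congr 1
    omega
  rw [hp] at h1
  refine mul_left_cancel₀ (pow_ne_zero (2 * peaks w + 1) one_add_X_ne_zero) ?_
  linear_combination (mk fun k => ((w.length + 1).multichoose k : ℚ)) * h1 -
    (1 + X) ^ (2 * peaks w + 1) * gf w * hB

theorem coeff_one_add_X_pow' (n k : ℕ) : coeff k ((1 + X : ℚ⟦X⟧) ^ n) = (n.choose k : ℚ) := by
  rw [← Polynomial.coeff_one_add_X_pow ℚ n k, ← Polynomial.coeff_coe]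
  simp

theorem ordPoly_eq {w : List ℕ+} (h0 : w ≠ []) (hw : w.Nodup) (m : ℕ) :
    ordPoly m w = 2 ^ (2 * peaks w + 1) * ∑ k ∈ Finset.range (m - peaks w),
      ((w.length + 1).multichoose k : ℚ) *
        ((w.length - 2 * peaks w - 1).choose (m - 1 - peaks w - k) : ℚ) := by
  have h1 : ordPoly m w = coeff m (gf w) := by rw [gf, coeff_mk]
  have h2 : (2 ^ (2 * peaks w + 1) : ℚ⟦X⟧) = C (2 ^ (2 * peaks w + 1)) := by
    rw [map_pow, map_ofNat]
  rw [h1, gf_eq h0 hw, h2, coeff_C_mul, coeff_X_pow_mul']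
  congr 1
  split_ifs with hm
  · rw [coeff_mul, Finset.Nat.sum_antidiagonal_eq_sum_range_succ_mk]
    rw [show (m - (peaks w + 1)).succ = m - peaks w by omega]
    refine Finset.sum_congr rfl fun k _ => ?_
    rw [coeff_mk, coeff_one_add_X_pow', show m - (peaks w + 1) - k = m - 1 - peaks w - k by omega]
  · rw [show m - peaks w = 0 by omega, Finset.sum_range_zero]

theorem peaks_eq_sum (w : List ℕ+) :
    peaks w = ∑ i ∈ Finset.range (w.length - 2),
      if w.getD i 1 < w.getD (i + 1) 1 ∧ w.getD (i + 2) 1 < w.getD (i + 1) 1 then 1 else 0 := by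
  match w with
  | [] => simp [peaks]
  | [a] => simp [peaks]
  | [a, b] => simp [peaks]
  | a :: b :: c :: w =>
    have ih := peaks_eq_sum (b :: c :: w)
    rw [peaks, ih]
    simp only [List.length_cons]
    rw [show w.length + 1 + 1 + 1 - 2 = w.length + 1 by omega,
      show w.length + 1 + 1 - 2 = w.length by omega, Finset.sum_range_succ', add_comm]
    simp

theorem pk_eq_peaks (π : LinPerm) : π.pk = peaks π.1 := by
  rw [peaks_eq_sum, ← Finset.card_filter]
  -- `Pk` records the middle letter of a peak, counted from `1`; the sum is indexed by the left
  -- letter, counted from `0`. Hence the shift by two.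
  refine Finset.card_bij' (fun i _ => i - 2) (fun i _ => i + 2) ?_ ?_ ?_ ?_
  · intro i hi
    rw [Pk, Finset.mem_filter, Finset.mem_Icc] at hi
    obtain ⟨⟨h1, h2⟩, h3⟩ := hi
    obtain ⟨i, rfl⟩ := Nat.exists_eq_add_of_le' h1
    rw [Finset.mem_filter, Finset.mem_range]
    refine ⟨?_, by simpa [letter] using h3⟩
    simp only [len] at h2
    omega
  · intro i hi
    rw [Finset.mem_filter, Finset.mem_range] at hi
    rw [Pk, Finset.mem_filter, Finset.mem_Icc]
    refine ⟨⟨by omega, ?_⟩, by simpa [letter] using hi.2⟩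
    simp only [len]
    omega
  · intro i hi
    rw [Pk, Finset.mem_filter, Finset.mem_Icc] at hi
    exact Nat.sub_add_cancel hi.1.1
  · intro i hi
    simp

/-! ### Images of classes: products, independence and shuffle compatibility. -/

theorem peakImage_apply (π : LinPerm) (m : ℕ) :
    peakImage π m = Polynomial.monomial π.len (ordPoly m π.1) := by
  rw [peakImage]
  split_ifs with h0
  · have h : π.1 = [] := List.length_eq_zero_iff.1 h0
    rw [h0, h, ordPoly_nil]
    rfl
  · have h : π.1 ≠ [] := fun h => h0 (by rw [len, h, List.length_nil])
    rw [ordPoly_eq h π.2, peakFun, pk_eq_peaks]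
    rfl

theorem peakImage_mul {π σ : LinPerm} (d : Disj π σ) :
    peakImage π * peakImage σ = ∑ τ ∈ shuffle π σ d, peakImage τ := by
  funext m
  rw [Pi.mul_apply, Finset.sum_apply, peakImage_apply, peakImage_apply,
    Polynomial.monomial_mul_monomial, ← isShuffleChar_ordPoly m π.1 σ.1 fun a ha hb => d a ha hb,
    ← sum_shuffle d, map_sum]
  refine Finset.sum_congr rfl fun τ hτ => ?_
  rw [peakImage_apply, (mem_shuffle.1 hτ).1]

/-- The image of a class. -/
noncomputable def classImage : PkClass → ℕ → ℚ[X] :=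
  Quotient.lift peakImage fun π σ h => by
    have h : pk π = pk σ ∧ π.len = σ.len := h
    rw [peakImage, peakImage, h.1, h.2]

theorem classImage_toClass (π : LinPerm) : classImage (toClass π) = peakImage π := rfl

theorem exists_toClass (c : PkClass) : ∃ π, toClass π = c := Quotient.exists_rep c

theorem peakImage_eq_zero_of_le {π : LinPerm} (h0 : π.len ≠ 0) {m : ℕ} (hm : m ≤ π.pk) :
    peakImage π m = 0 := by
  rw [peakImage, if_neg h0, peakFun, Nat.sub_eq_zero_of_le hm]
  simp

theorem peakImage_pk_succ {π : LinPerm} (h0 : π.len ≠ 0) :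
    peakImage π (π.pk + 1) = Polynomial.monomial π.len (2 ^ (2 * π.pk + 1)) := by
  rw [peakImage, if_neg h0, peakFun]
  simp

theorem coeff_peakImage_of_ne {π : LinPerm} {n : ℕ} (h : π.len ≠ n) (m : ℕ) :
    (peakImage π m).coeff n = 0 := by
  rw [peakImage_apply, Polynomial.coeff_monomial, if_neg h]

/-- In degree `n`, the function with `j` peaks vanishes for `m ≤ j` but not at `m = j + 1`. In a
vanishing combination, the coefficient of `x^n` at `m = j + 1` therefore involves only classes of
length `n` with at most `j` peaks, and those with fewer peaks are removed by induction on `j`. -/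
theorem linearIndependent_classImage : LinearIndependent ℚ classImage := by
  rw [linearIndependent_iff]
  intro x hx
  have hco : ∀ m n, ∑ c ∈ x.support, x c * (classImage c m).coeff n = 0 := by
    intro m n
    have := congrArg (fun f : ℕ → ℚ[X] => (f m).coeff n) hx
    simpa [Finsupp.linearCombination_apply, Finsupp.sum, Finset.sum_apply] using this
  suffices h : ∀ (j : ℕ) (π : LinPerm), π.pk = j → x (toClass π) = 0 by
    ext c
    obtain ⟨π, rfl⟩ := exists_toClass c
    exact h _ π rfl
  intro j
  induction j using Nat.strong_induction_on with | _ j ih => ?_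
  intro π hj
  have hs := hco (π.pk + 1) π.len
  have hzero : ∀ σ : LinPerm, toClass σ ≠ toClass π →
      x (toClass σ) * (classImage (toClass σ) (π.pk + 1)).coeff π.len = 0 := by
    intro σ hne
    rw [classImage_toClass]
    by_cases hl : σ.len = π.len
    · have hp : σ.pk ≠ π.pk := fun hp => hne (toClass_eq_iff.2 ⟨hp, hl⟩)
      rcases lt_or_gt_of_ne hp with hp | hp
      · rw [ih _ (hj ▸ hp) σ rfl, zero_mul]
      · have h0 : σ.len ≠ 0 := by
          intro h0
          have : σ.1 = [] := List.length_eq_zero_iff.1 h0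
          rw [pk_eq_peaks σ, this] at hp
          simp [peaks] at hp
        rw [peakImage_eq_zero_of_le h0 (by omega), Polynomial.coeff_zero, mul_zero]
    · rw [coeff_peakImage_of_ne hl, mul_zero]
  by_contra hne
  rw [Finset.sum_eq_single_of_mem (toClass π) (Finsupp.mem_support_iff.2 hne)
    fun c _ hc => by obtain ⟨σ, rfl⟩ := exists_toClass c; exact hzero σ hc] at hs
  refine mul_ne_zero hne ?_ hs
  rw [classImage_toClass]
  by_cases h0 : π.len = 0
  · rw [peakImage, if_pos h0, h0]
    simp
  · rw [peakImage_pk_succ h0, Polynomial.coeff_monomial, if_pos rfl]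
    positivity

/-- The sum of images over the shuffles is a product that depends only on the two classes.
Independence lifts this equality to formal sums of classes, whose coefficients are the
multiplicities of the classes among the shuffles. -/
theorem shuffleCompatible_pk : ShuffleCompatible pk := by
  classical
  intro π σ π' σ' d d' hπ hσ hπl hσl
  have e1 : peakImage π = peakImage π' := by rw [peakImage, peakImage, hπ, hπl]
  have e2 : peakImage σ = peakImage σ' := by rw [peakImage, peakImage, hσ, hσl]
  have e : ∑ τ ∈ shuffle π σ d, peakImage τ = ∑ τ ∈ shuffle π' σ' d', peakImage τ := by
    rw [← peakImage_mul, ← peakImage_mul, e1, e2]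
  have e3 : ∑ τ ∈ shuffle π σ d, Finsupp.single (toClass τ) (1 : ℚ) =
      ∑ τ ∈ shuffle π' σ' d', Finsupp.single (toClass τ) (1 : ℚ) := by
    apply linearIndependent_classImage
    simpa [map_sum, classImage_toClass] using e
  have e4 : (shuffle π σ d).val.map toClass = (shuffle π' σ' d').val.map toClass := by
    ext c
    have := congrArg (fun f => f c) e3
    simp only [Finsupp.finsetSum_apply, Finsupp.single_apply, Finset.sum_boole] at this
    rw [Multiset.count_map, Multiset.count_map]
    simpa [Finset.card, eq_comm] using this
  have e5 := congrArg (Multiset.map fun c : PkClass =>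
    Quotient.liftOn c pk fun _ _ h => h.1) e4
  simpa [Multiset.map_map, Function.comp_def, toClass] using e5

/-! ### Realizable pairs of length and peak number. -/

/-- With `N` above all letters of `w`, prefixing `N` creates only a descent, while prefixing `N, N +
1` creates exactly one new peak, at `N + 1`. -/
theorem exists_word (j k : ℕ) : ∃ w : List ℕ+, w.Nodup ∧ w.length = k + 1 + 2 * j ∧
    peaks w = j := by
  have fresh : ∀ w : List ℕ+, ∃ N : ℕ+, ∀ a ∈ w, a < N := by
    intro w
    obtain ⟨N, hN⟩ := w.toFinset.bddAbove
    exact ⟨N + 1, fun a ha => PNat.lt_add_one_iff.2 (hN (by simpa using ha))⟩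
  induction j with
  | zero =>
    induction k with
    | zero => exact ⟨[1], by simp [peaks]⟩
    | succ k ih =>
      obtain ⟨w, h1, h2, h3⟩ := ih
      obtain ⟨N, hN⟩ := fresh w
      refine ⟨N :: w, List.nodup_cons.2 ⟨fun h => lt_irrefl _ (hN N h), h1⟩, by simp; omega, ?_⟩
      cases w with
      | nil => simp at h2
      | cons b w => rw [peaks_of_gt w (hN b List.mem_cons_self), h3]
  | succ j ih =>
    obtain ⟨w, h1, h2, h3⟩ := ih
    obtain ⟨N, hN⟩ := fresh w
    have hN' : N < N + 1 := PNat.lt_add_right N 1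
    refine ⟨N :: (N + 1) :: w, ?_, by simp; omega, ?_⟩
    · rw [List.nodup_cons, List.nodup_cons, List.mem_cons]
      refine ⟨?_, fun h => lt_asymm hN' (hN _ h), h1⟩
      rintro (h | h)
      · exact hN'.ne h
      · exact lt_irrefl _ (hN N h)
    · cases w with
      | nil => rw [List.length_nil] at h2; omega
      | cons b w =>
        rw [peaks_of_peak w hN' ((hN b List.mem_cons_self).trans hN'), h3, add_comm]

theorem range_classImage : Set.range classImage =
    {1} ∪ {f | ∃ n j : ℕ, 1 ≤ n ∧ j ≤ (n - 1) / 2 ∧ f = peakFun n j} := by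
  ext f
  constructor
  · rintro ⟨c, rfl⟩
    obtain ⟨π, rfl⟩ := exists_toClass c
    rw [classImage_toClass, peakImage]
    split_ifs with h0
    · exact Or.inl rfl
    · refine Or.inr ⟨π.len, π.pk, Nat.one_le_iff_ne_zero.2 h0, ?_, rfl⟩
      have h : π.1 ≠ [] := fun h => h0 (by rw [len, h, List.length_nil])
      have := two_mul_peaks_lt h π.2
      rw [pk_eq_peaks, len]
      omega
  · rintro (rfl | ⟨n, j, hn, hj, rfl⟩)
    · exact ⟨toClass ⟨[], List.nodup_nil⟩, rfl⟩
    · obtain ⟨w, h1, h2, h3⟩ := exists_word j (n - 1 - 2 * j)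
      refine ⟨toClass ⟨w, h1⟩, ?_⟩
      have hl : len ⟨w, h1⟩ = n := by
        change w.length = n
        omega
      rw [classImage_toClass, peakImage, hl, if_neg (by omega), pk_eq_peaks, h3]

/-! ### The algebra isomorphism. -/

variable (h : ShuffleCompatible pk)

/-- The linear extension of `classImage`. -/
noncomputable def toFunLin : PkAlgebra h →ₗ[ℚ] ℕ → ℚ[X] :=
  (PkAlgebra.basis h).constr ℚ classImage

theorem toFunLin_cls (π : LinPerm) : toFunLin h (PkAlgebra.cls h π) = peakImage π := by
  rw [toFunLin, PkAlgebra.cls, Module.Basis.constr_basis, classImage_toClass]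

theorem toFunLin_mul (x y : PkAlgebra h) :
    toFunLin h (x * y) = toFunLin h x * toFunLin h y := by
  induction x using PkAlgebra.induction_cls [] with
  | h0 => rw [zero_mul, map_zero, zero_mul]
  | hadd a b ha hb => rw [add_mul, map_add, map_add, add_mul, ha, hb]
  | hsmul r a ha => rw [smul_mul_assoc, map_smul, map_smul, smul_mul_assoc, ha]
  | hcls π _ =>
  induction y using PkAlgebra.induction_cls π.1 with
  | h0 => rw [mul_zero, map_zero, mul_zero]
  | hadd a b ha hb => rw [mul_add, map_add, map_add, mul_add, ha, hb]
  | hsmul r a ha => rw [mul_smul_comm, map_smul, map_smul, mul_smul_comm, ha]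
  | hcls σ hσ =>
  have d : Disj π σ := fun a ha hb => hσ a hb ha
  rw [PkAlgebra.cls_mul_cls d, map_sum, toFunLin_cls, toFunLin_cls, peakImage_mul d]
  exact Finset.sum_congr rfl fun τ _ => toFunLin_cls h τ

/-- The algebra homomorphism sending `[π]_pk` to `peakImage π`. -/
noncomputable def toFunAlg : PkAlgebra h →ₐ[ℚ] ℕ → ℚ[X] :=
  AlgHom.ofLinearMap (toFunLin h)
    ((toFunLin_cls h ⟨[], List.nodup_nil⟩).trans (if_pos rfl)) (toFunLin_mul h)

theorem toFunAlg_injective : Function.Injective (toFunAlg h) :=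
  (PkAlgebra.basis h).injective_constr_of_linearIndependent (R₂ := ℚ)
    linearIndependent_classImage

theorem toSubmodule_range_toFunAlg : Subalgebra.toSubmodule (toFunAlg h).range =
    Submodule.span ℚ ({1} ∪ {f | ∃ n j : ℕ, 1 ≤ n ∧ j ≤ (n - 1) / 2 ∧ f = peakFun n j}) := by
  rw [← range_classImage]
  exact Module.Basis.constr_range (S := ℚ) (PkAlgebra.basis h)

end PeakShuffle

theorem mainTheorem8 :
    ∃ (h : ShuffleCompatible LinPerm.pk) (S : Subalgebra ℚ (ℕ → ℚ[X])),
      Subalgebra.toSubmodule S =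
        Submodule.span ℚ ({1} ∪ {f | ∃ n j : ℕ, 1 ≤ n ∧ j ≤ (n - 1) / 2 ∧ f = peakFun n j}) ∧
      ∃ e : PkAlgebra h ≃ₐ[ℚ] S,
        ∀ π : LinPerm, (e (PkAlgebra.cls h π) : ℕ → ℚ[X]) = peakImage π := by
  have h := PeakShuffle.shuffleCompatible_pk
  exact ⟨h, (PeakShuffle.toFunAlg h).range, PeakShuffle.toSubmodule_range_toFunAlg h,
    AlgEquiv.ofInjective _ (PeakShuffle.toFunAlg_injective h), PeakShuffle.toFunLin_cls h⟩
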